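/- Let $E=(E^0,E^1,r,s)$ be a topological graph: $E^0,E^1$ are locally compact Hausdorff spaces, $r:E^1\to E^0$ is continuous, and $s:E^1\to E^0$ is a local homeomorphism. An $s$-section is a subset of $E^1$ on which $s$ restricts to a homeomorphism onto its image; $r$-sections are defined in the same way, and a bisection is a set that is both. Put $E^0_{\mathrm{sce}}=E^0\setminus\overline{r(E^1)}$, let $E^0_{\mathrm{fin}}$ be the set of $v\in E^0$ that have a neighbourhood $N$ with $r^{-1}(N)$ compact, and let $E^0_{\mathrm{rg}}=E^0_{\mathrm{fin}}\setminus\overline{E^0_{\mathrm{sce}}}$, an open set. For a function $x$ write $\mathrm{osupp}(x)=\{x\neq 0\}$ and $\mathrm{supp}(x)=\overline{\mathrm{osupp}(x)}$. Identify $C_c(E^0_{\mathrm{rg}})\subset C_0(E^0_{\mathrm{rg}})$ with their images in $C_0(E^0)$ under extension by zero. A Toeplitz representation of $E$ in a $C^*$-algebra $B$ is a pair $(\psi,\pi)$ of a linear map $\psi:C_c(E^1)\to B$ and a $*$-homomorphism $\pi:C_0(E^0)\to B$ such that (1) $\psi((f\circ r)\,x)=\pi(f)\psi(x)$ for $f\in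 C_0(E^0)$, $x\in C_c(E^1)$; (2) if $x\in C_c(E^1)$ and $\mathrm{supp}(x)$ lies in an open $s$-section, then $\psi(x)^*\psi(x)=\pi(\widehat x)$, where $\widehat x(s(e))=|x(e)|^2$ for $e\in\mathrm{osupp}(x)$ and $\widehat x=0$ off $s(\mathrm{osupp}(x))$; (3) if $x,y\in C_c(E^1)$ have supports contained in disjoint open $s$-sections, then $\psi(x)^*\psi(y)=0$. A Toeplitz representation $(\psi,\pi)$ is covariant if there is a collection $\mathcal G\subset C_c(E^0_{\mathrm{rg}})$ of nonnegative functions which generates $C_0(E^0_{\mathrm{rg}})$ as a $C^*$-algebra such that for each $f\in\mathcal G$ there are a finite cover $\mathcal N_f$ of $r^{-1}(\mathrm{supp} f)$ by open $s$-sections and nonnegative functions $f_N\in C_c(E^1)$ $(N\in\mathcal N_f)$ with $\mathrm{osupp}(f_N)\subset N\cap r^{-1}(\mathrm{supp} f)$ for all $N$, $\sum_{N}f_N=f\circ r$, and $\pi(f)=\sum_{N}\psi(\sqrt{f_N})\psi(\sqrt{f_N})^*$. A local $r$-fibration is a pair $(\mathcal U,V)$ of a subset $V\subset E^0$ and a finite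 collection $\mathcal U$ of mutually disjoint bisections such that $r^{-1}(V)=\bigcup_{U\in\mathcal U}U$ and $r(U)=V$ for each $U\in\mathcal U$; it is open if $V$ and all $U\in\mathcal U$ are open. For an open local $r$-fibration $(\mathcal U,V)$, a function $f\in C_c(E^0)$ with $\mathrm{supp}(f)\subset V$, and $U\in\mathcal U$, let $r_U^*f\in C_c(E^1)$ be equal to $f\circ r$ on $U$ and to $0$ off $U$. **Corollary.** Suppose that $r$ is a local homeomorphism and $r(E^1)$ is closed in $E^0$. Let $(\psi,\pi)$ be a Toeplitz representation of $E$ in a $C^*$-algebra $B$. Then $(\psi,\pi)$ is covariant if and only if there is a collection $\mathcal G\subset C_c(E^0_{\mathrm{rg}})$ of nonnegative functions which generates $C_0(E^0_{\mathrm{rg}})$ as a $C^*$-algebra such that for each $f\in\mathcal G$ there is an open local $r$-fibration $(\mathcal U,V)$ with $\mathrm{supp}(f)\subset V$ and $$\pi(f)=\sum_{U\in\mathcal U}\psi\big(\sqrt{r_U^*f}\big)\,\psi\big(\sqrt{r_U^*f}\big)^*.\qquad(*)$$ Moreover, if $(\psi,\pi)$ is covariant, then $(*)$ holds for every nonnegative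 $f\in C_c(E^0_{\mathrm{rg}})$ and every open local $r$-fibration $(\mathcal U,V)$ with $\mathrm{supp}(f)\subset V$. -/

import Mathlib

open Set Topology
open scoped NNReal ZeroAtInfty CompactlySupported

/-- A topological graph with vertex space `V` and edge space `D`: the range map `r` is continuous
and the source map `s` is a local homeomorphism. (Local compactness and the Hausdorff property of
the two spaces are carried by the type class arguments.) -/
structure TopologicalGraph (V D : Type*) [TopologicalSpace V] [T2Space V] [LocallyCompactSpace V]
    [TopologicalSpace D] [T2Space D] [LocallyCompactSpace D] where
  r : D → V
  s : D → V
  continuous_r : Continuous r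
  isLocalHomeomorph_s : IsLocalHomeomorph s

/-- A function which is continuous on an open set `W` and vanishes off a compact subset of `W` is
continuous with compact support. -/
theorem continuous_and_hasCompactSupport_of_vanish_off {X Y : Type*} [TopologicalSpace X]
    [T2Space X] [TopologicalSpace Y] [Zero Y] {g : X → Y} {K W : Set X} (hK : IsCompact K)
    (hKW : K ⊆ W) (hg : ∀ x ∈ W, ContinuousAt g x) (h0 : ∀ x, x ∉ K → g x = 0) :
    Continuous g ∧ HasCompactSupport g := by
  refine ⟨continuous_iff_continuousAt.2 fun x => ?_, HasCompactSupport.intro hK fun {x} => h0 x⟩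
  by_cases hx : x ∈ W
  · exact hg x hx
  · have hxK : Kᶜ ∈ 𝓝 x := hK.isClosed.isOpen_compl.mem_nhds fun h => hx (hKW h)
    have : g =ᶠ[𝓝 x] fun _ => (0 : Y) := by
      filter_upwards [hxK] with y hy using h0 y hy
    exact continuousAt_const.congr this.symm

/-- The inclusion of `C_c(X)` in `C₀(X)`. -/
noncomputable def CompactlySupportedContinuousMap.toC0 {X : Type*} [TopologicalSpace X] (f : C_c(X, ℂ)) :
    C₀(X, ℂ) where
  toFun := f
  continuous_toFun := f.continuous
  zero_at_infty' := f.hasCompactSupport.is_zero_at_infty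

/-- A nonnegative compactly supported continuous function, regarded as a complex valued one. -/
noncomputable def CompactlySupportedContinuousMap.toComplex {X : Type*} [TopologicalSpace X]
    (f : C_c(X, ℝ≥0)) : C_c(X, ℂ) where
  toFun x := ((f x : ℝ) : ℂ)
  continuous_toFun := Complex.continuous_ofReal.comp (NNReal.continuous_coe.comp f.continuous)
  hasCompactSupport' := f.hasCompactSupport.comp_left (g := fun t : ℝ≥0 => ((t : ℝ) : ℂ)) (by simp)

/-- The pointwise square root of a nonnegative compactly supported continuous function. -/
noncomputable def CompactlySupportedContinuousMap.sqrt {X : Type*} [TopologicalSpace X]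
    (f : C_c(X, ℝ≥0)) : C_c(X, ℝ≥0) where
  toFun x := NNReal.sqrt (f x)
  continuous_toFun := NNReal.continuous_sqrt.comp f.continuous
  hasCompactSupport' := f.hasCompactSupport.comp_left (g := fun t : ℝ≥0 => NNReal.sqrt t) (by simp)

namespace TopologicalGraph

variable {V D : Type*} [TopologicalSpace V] [T2Space V] [LocallyCompactSpace V]
  [TopologicalSpace D] [T2Space D] [LocallyCompactSpace D] (E : TopologicalGraph V D)

/-- `s` restricts to a homeomorphism of `U` onto `s(U)`. -/
def IsSSection (U : Set D) : Prop := IsEmbedding (U.domRestrict E.s)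

/-- `r` restricts to a homeomorphism of `U` onto `r(U)`. -/
def IsRSection (U : Set D) : Prop := IsEmbedding (U.domRestrict E.r)

/-- Both an `s`-section and an `r`-section. -/
def IsBisection (U : Set D) : Prop := E.IsSSection U ∧ E.IsRSection U

/-- The set of sources `E⁰_sce`: the complement of the closure of `r(E¹)`. -/
def sce : Set V := (closure (range E.r))ᶜ

/-- `E⁰_fin`: the vertices having a neighbourhood `N` with `r⁻¹(N)` compact. -/
def fin : Set V := {v | ∃ N ∈ 𝓝 v, IsCompact (E.r ⁻¹' N)}

/-- The set of regular vertices `E⁰_rg`. -/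
def rg : Set V := E.fin \ closure E.sce

/-- The left action `(f · x)(e) = f(r(e)) x(e)` of `C₀(E⁰)` on `C_c(E¹)`. -/
noncomputable def lact (f : C₀(V, ℂ)) (x : C_c(D, ℂ)) : C_c(D, ℂ) where
  toFun e := f (E.r e) * x e
  continuous_toFun := ((map_continuous f).comp E.continuous_r).mul x.continuous
  hasCompactSupport' := x.hasCompactSupport.mul_left (f := fun e => f (E.r e))

open Classical in
/-- The underlying function of `x̂`: its value is `|x(e)|²` at `s(e)` if `x(e) ≠ 0`, and it is `0`
off `s({x ≠ 0})`. (It is meaningful if `s` is injective on `{x ≠ 0}`.) -/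
noncomputable def hatFun (x : C_c(D, ℂ)) (v : V) : ℂ :=
  if h : ∃ e, x e ≠ 0 ∧ E.s e = v then ((‖x h.choose‖ ^ 2 : ℝ) : ℂ) else 0

theorem IsSSection.injOn {E : TopologicalGraph V D} {U : Set D} (hU : E.IsSSection U) :
    InjOn E.s U := injOn_iff_injective.2 hU.injective

theorem hatFun_s (x : C_c(D, ℂ)) {U : Set D} (hs : E.IsSSection U) (hx : tsupport x ⊆ U)
    {e : D} (he : e ∈ U) : E.hatFun x (E.s e) = ((‖x e‖ ^ 2 : ℝ) : ℂ) := by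
  have key : ∀ e', x e' ≠ 0 → E.s e' = E.s e → e' = e := fun e' h1 h2 =>
    hs.injOn (hx (subset_tsupport _ h1)) he h2
  unfold hatFun
  split_ifs with h
  · rw [key _ h.choose_spec.1 h.choose_spec.2]
  · have : x e = 0 := by
      by_contra h0
      exact h ⟨e, h0, rfl⟩
    simp [this]

theorem hatFun_eq_zero (x : C_c(D, ℂ)) {v : V} (hv : v ∉ E.s '' Function.support x) :
    E.hatFun x v = 0 := dif_neg hv

theorem hatFun_continuous (x : C_c(D, ℂ)) {U : Set D} (hU : IsOpen U) (hs : E.IsSSection U)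
    (hx : tsupport x ⊆ U) : Continuous (E.hatFun x) ∧ HasCompactSupport (E.hatFun x) := by
  refine continuous_and_hasCompactSupport_of_vanish_off (K := E.s '' tsupport x) (W := E.s '' U)
    (x.hasCompactSupport.isCompact.image E.isLocalHomeomorph_s.continuous) (image_mono hx) ?_ ?_
  · rintro _ ⟨e, he, rfl⟩
    have hc : ContinuousAt (fun e => ((‖x e‖ ^ 2 : ℝ) : ℂ)) e :=
      (Complex.continuous_ofReal.comp (x.continuous.norm.pow 2)).continuousAt
    have hc' : ContinuousAt (fun e => E.hatFun x (E.s e)) e := by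
      refine hc.congr ?_
      filter_upwards [hU.mem_nhds he] with e' he' using (E.hatFun_s x hs hx he').symm
    rw [ContinuousAt, ← E.isLocalHomeomorph_s.map_nhds_eq e, Filter.tendsto_map'_iff]
    exact hc'
  · exact fun v hv => E.hatFun_eq_zero x fun h => hv (image_mono (subset_tsupport _) h)

/-- The element `x̂` of `C₀(E⁰)`, for `x ∈ C_c(E¹)` with support inside an open `s`-section. -/
noncomputable def hat (x : C_c(D, ℂ)) {U : Set D} (hU : IsOpen U) (hs : E.IsSSection U)
    (hx : tsupport x ⊆ U) : C₀(V, ℂ) where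
  toFun := E.hatFun x
  continuous_toFun := (E.hatFun_continuous x hU hs hx).1
  zero_at_infty' := (E.hatFun_continuous x hU hs hx).2.is_zero_at_infty

/-- A Toeplitz representation `(ψ, π)` of `E` in the C*-algebra `B`. -/
structure ToeplitzRep (B : Type*) [NonUnitalCStarAlgebra B] where
  psi : C_c(D, ℂ) →ₗ[ℂ] B
  pi : C₀(V, ℂ) →⋆ₙₐ[ℂ] B
  psi_lact : ∀ (f : C₀(V, ℂ)) (x : C_c(D, ℂ)), psi (E.lact f x) = pi f * psi x
  pi_hat : ∀ (x : C_c(D, ℂ)) (U : Set D) (hU : IsOpen U) (hs : E.IsSSection U)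
    (hx : tsupport x ⊆ U), pi (E.hat x hU hs hx) = star (psi x) * psi x
  psi_disjoint : ∀ (x y : C_c(D, ℂ)) (U W : Set D), IsOpen U → E.IsSSection U →
    IsOpen W → E.IsSSection W → Disjoint U W → tsupport x ⊆ U → tsupport y ⊆ W →
    star (psi x) * psi y = 0

/-- The collection `G` of nonnegative compactly supported functions on `E⁰` lies in `C_c(E⁰_rg)`
and generates `C₀(E⁰_rg)` as a C*-algebra. Here `C_c(E⁰_rg)` is identified with the functions in
`C_c(E⁰)` whose support lies in `E⁰_rg`, and `C₀(E⁰_rg)` with the ideal of those functions in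
`C₀(E⁰)` that vanish off `E⁰_rg`. -/
def IsGeneratingFamily (G : Set C_c(V, ℝ≥0)) : Prop :=
  (∀ f ∈ G, tsupport f ⊆ E.rg) ∧
    ((NonUnitalStarAlgebra.adjoin ℂ
        ((fun f : C_c(V, ℝ≥0) => f.toComplex.toC0) '' G)).topologicalClosure : Set C₀(V, ℂ)) =
      {g | ∀ v, v ∉ E.rg → g v = 0}

/-- Covariance of a Toeplitz representation. -/
def ToeplitzRep.IsCovariant {E : TopologicalGraph V D} {B : Type*} [NonUnitalCStarAlgebra B]
    (R : E.ToeplitzRep B) : Prop :=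
  ∃ G : Set C_c(V, ℝ≥0), E.IsGeneratingFamily G ∧
    ∀ f ∈ G, ∃ (𝒩 : Finset (Set D)) (fN : Set D → C_c(D, ℝ≥0)),
      (∀ N ∈ 𝒩, IsOpen N ∧ E.IsSSection N) ∧
      (E.r ⁻¹' tsupport f ⊆ ⋃ N ∈ 𝒩, N) ∧
      (∀ N ∈ 𝒩, Function.support (fN N) ⊆ N ∩ E.r ⁻¹' tsupport f) ∧
      (∀ e, ∑ N ∈ 𝒩, fN N e = f (E.r e)) ∧
      R.pi f.toComplex.toC0 =
        ∑ N ∈ 𝒩, R.psi (fN N).sqrt.toComplex * star (R.psi (fN N).sqrt.toComplex)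

/-- A local `r`-fibration `(𝒰, V)`: the finite collection `sheets` consists of mutually disjoint
bisections with union `r⁻¹(base)`, each with range `base`. -/
structure LocalRFibration where
  sheets : Finset (Set D)
  base : Set V
  isBisection : ∀ U ∈ sheets, E.IsBisection U
  pairwiseDisjoint : (sheets : Set (Set D)).PairwiseDisjoint id
  preimage_base : E.r ⁻¹' base = ⋃ U ∈ sheets, U
  image_sheet : ∀ U ∈ sheets, E.r '' U = base

/-- A local `r`-fibration is open if its sheets and its base are open. -/
def LocalRFibration.IsOpenFibration {E : TopologicalGraph V D} (F : E.LocalRFibration) : Prop :=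
  (∀ U ∈ F.sheets, IsOpen U) ∧ IsOpen F.base

theorem LocalRFibration.continuous_indicator {E : TopologicalGraph V D} (F : E.LocalRFibration)
    (hF : F.IsOpenFibration) (f : C_c(V, ℝ≥0)) (hf : tsupport f ⊆ F.base) {U : Set D}
    (hU : U ∈ F.sheets) :
    Continuous (U.indicator (f ∘ E.r)) ∧ HasCompactSupport (U.indicator (f ∘ E.r)) := by
  have hc : IsCompact (U.domRestrict E.r ⁻¹' tsupport f) := by
    refine ((F.isBisection U hU).2.isInducing.isCompact_preimage_iff ?_).2
      f.hasCompactSupport.isCompact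
    rw [range_domRestrict, F.image_sheet U hU]
    exact hf
  refine continuous_and_hasCompactSupport_of_vanish_off
    (K := Subtype.val '' (U.domRestrict E.r ⁻¹' tsupport f)) (W := U)
    (hc.image continuous_subtype_val) ?_ ?_ ?_
  · rintro _ ⟨e, -, rfl⟩
    exact e.2
  · intro e he
    have : ContinuousAt (f ∘ E.r) e := (f.continuous.comp E.continuous_r).continuousAt
    refine this.congr ?_
    filter_upwards [(hF.1 U hU).mem_nhds he] with e' he' using (indicator_of_mem he' _).symm
  · intro e he
    by_cases heU : e ∈ U
    · rw [indicator_of_mem heU]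
      by_contra h0
      exact he ⟨⟨e, heU⟩, subset_tsupport _ h0, rfl⟩
    · exact indicator_of_notMem heU _

/-- The function `r_U^* f ∈ C_c(U) ⊆ C_c(E¹)` equal to `f ∘ r` on the sheet `U` and to `0` off `U`,
for `f` with support inside the base of an open local `r`-fibration. -/
noncomputable def LocalRFibration.pullback {E : TopologicalGraph V D} (F : E.LocalRFibration)
    (hF : F.IsOpenFibration) (f : C_c(V, ℝ≥0)) (hf : tsupport f ⊆ F.base) {U : Set D}
    (hU : U ∈ F.sheets) : C_c(D, ℝ≥0) where
  toFun := U.indicator (f ∘ E.r)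
  continuous_toFun := (F.continuous_indicator hF f hf hU).1
  hasCompactSupport' := (F.continuous_indicator hF f hf hU).2

/-- The identity `π(f) = ∑_{U ∈ 𝒰} ψ(√(r_U^* f)) ψ(√(r_U^* f))^*`. -/
def ToeplitzRep.FibrationIdentity {E : TopologicalGraph V D} {B : Type*}
    [NonUnitalCStarAlgebra B] (R : E.ToeplitzRep B) (f : C_c(V, ℝ≥0)) (F : E.LocalRFibration)
    (hF : F.IsOpenFibration) (hf : tsupport f ⊆ F.base) : Prop :=
  R.pi f.toComplex.toC0 =
    ∑ U ∈ F.sheets.attach, R.psi (F.pullback hF f hf U.2).sqrt.toComplex *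
      star (R.psi (F.pullback hF f hf U.2).sqrt.toComplex)

end TopologicalGraph

/-! Everything rests on comparing both sides of (*) inside the closed span `compacts` of the
elements ψ(x)ψ(y)^*, where an element b is determined by its products bψ(y): if they all vanish then
bb^* = 0, because b^* is again a limit of sums of elements ψ(x)ψ(y)^* (`eq_zero_of_mem_compacts`).

The right side of (*) lies in `compacts` by form. The left side does so under covariance: this holds
on generators, and `compacts` is closed, self-adjoint and stable under left multiplication by π
(`pi_mem_compacts`). Both sides act equally on each ψ(y) for any Toeplitz representation
(`sum_pullback_mul_psi`): a partition of unity reduces to y with small support, where at most one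
sheet contributes and relation (2) decides.

Conversely, (*) is itself a covariance condition, with the sheets as cover. A generating family
exists because, for r a local homeomorphism, the fibre over a point of E⁰_fin is finite and every
such point lies in the base of an open local r-fibration (`exists_isOpenFibration`). -/

/-! ### Partitions of unity and local sections -/

/-- The product of a continuous function with a compactly supported continuous function. -/
noncomputable def CompactlySupportedContinuousMap.contMul {X : Type*} [TopologicalSpace X]
    (φ : C(X, ℂ)) (y : C_c(X, ℂ)) : C_c(X, ℂ) where
  toFun x := φ x * y x
  continuous_toFun := φ.continuous.mul y.continuous
  hasCompactSupport' := y.hasCompactSupport.mul_left (f := φ)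

/-- A submodule of `C_c(X)` contains `y` as soon as every point of the support of `y` has a
neighbourhood such that all functions supported there belong to the submodule. -/
theorem CompactlySupportedContinuousMap.mem_submodule_of_locally {X : Type*} [TopologicalSpace X]
    [T2Space X] [LocallyCompactSpace X] (S : Submodule ℂ C_c(X, ℂ)) (y : C_c(X, ℂ))
    (h : ∀ e ∈ tsupport y, ∃ W ∈ 𝓝 e, ∀ z : C_c(X, ℂ), tsupport z ⊆ W → z ∈ S) : y ∈ S := by
  choose! W hW hS using h
  obtain ⟨t, ht, hcov⟩ := y.hasCompactSupport.isCompact.elim_nhds_subcover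
    (fun e => interior (W e)) fun e he => interior_mem_nhds.2 (hW e he)
  have hcov' : tsupport y ⊆ ⋃ i : Fin t.card, interior (W (t.equivFin.symm i)) := by
    intro x hx
    obtain ⟨e, he, hxe⟩ := mem_iUnion₂.1 (hcov hx)
    exact mem_iUnion.2 ⟨t.equivFin ⟨e, he⟩, by simpa using hxe⟩
  obtain ⟨φ, hφs, hφ1, -, -⟩ := exists_continuous_sum_one_of_isOpen_isCompact
    (fun _ => isOpen_interior) y.hasCompactSupport.isCompact hcov'
  -- The φ i sum to one only on the support of y, which is enough since y vanishes elsewhere.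
  have hy : y = ∑ i, contMul ⟨fun x => ((φ i x : ℝ) : ℂ), by fun_prop⟩ y := by
    ext x
    rw [sum_apply]
    change y x = ∑ i, ((φ i x : ℝ) : ℂ) * y x
    rw [← Finset.sum_mul, ← Complex.ofReal_sum]
    by_cases hx : x ∈ tsupport y
    · have := hφ1 hx
      simp only [Finset.sum_apply, Pi.one_apply] at this
      simp [this]
    · simp [image_eq_zero_of_notMem_tsupport hx]
  rw [hy]
  refine Submodule.sum_mem _ fun i _ => hS _ (ht _ (t.equivFin.symm i).2) _ ?_
  refine (closure_mono fun x hx => ?_).trans ((hφs i).trans interior_subset)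
  have := left_ne_zero_of_mul (Function.mem_support.1 hx)
  simpa using this

theorem IsLocalHomeomorph.exists_isOpen_isEmbedding_domRestrict {X Y : Type*} [TopologicalSpace X]
    [TopologicalSpace Y] {f : X → Y} (hf : IsLocalHomeomorph f) (x : X) :
    ∃ U, IsOpen U ∧ x ∈ U ∧ IsEmbedding (U.domRestrict f) := by
  obtain ⟨U, hU, h⟩ := isLocalHomeomorph_iff_isOpenEmbedding_restrict.1 hf x
  exact ⟨interior U, isOpen_interior, mem_interior_iff_mem_nhds.2 hU,
    h.isEmbedding.comp (IsEmbedding.inclusion interior_subset)⟩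

theorem Topology.IsEmbedding.domRestrict_mono {X Y : Type*} [TopologicalSpace X]
    [TopologicalSpace Y] {f : X → Y} {U W : Set X} (h : IsEmbedding (U.domRestrict f))
    (hWU : W ⊆ U) : IsEmbedding (W.domRestrict f) :=
  h.comp (IsEmbedding.inclusion hWU)

/-! ### Inner products of the elements ψ(x) -/

namespace TopologicalGraph

variable {V D : Type*} [TopologicalSpace V] [T2Space V] [LocallyCompactSpace V]
  [TopologicalSpace D] [T2Space D] [LocallyCompactSpace D] {E : TopologicalGraph V D}
  {B : Type*} [NonUnitalCStarAlgebra B] (R : E.ToeplitzRep B)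

namespace ToeplitzRep

/-- Polarization of the relation `ψ(x)^* ψ(x) = π(x̂)` on an open `s`-section. -/
theorem exists_inner {U : Set D} (hU : IsOpen U) (hs : E.IsSSection U) {x y : C_c(D, ℂ)}
    (hx : tsupport x ⊆ U) (hy : tsupport y ⊆ U) :
    ∃ h : C₀(V, ℂ), R.pi h = star (R.psi x) * R.psi y ∧
      (∀ e ∈ U, h (E.s e) = star (x e) * y e) ∧ ∀ v ∉ E.s '' U, h v = 0 := by
  have hxy : ∀ c : ℂ, tsupport (x + c • y) ⊆ U := fun c =>
    closure_minimal (s := Function.support (x + c • y)) (t := tsupport x ∪ tsupport y)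
      (fun e he => by
        by_contra h
        rw [mem_union, not_or] at h
        exact he (by simp [image_eq_zero_of_notMem_tsupport h.1,
          image_eq_zero_of_notMem_tsupport h.2]))
      ((isClosed_tsupport x).union (isClosed_tsupport y)) |>.trans (union_subset hx hy)
  let Q : ℂ → C₀(V, ℂ) := fun c => E.hat (x + c • y) hU hs (hxy c)
  have hQ : ∀ c e, e ∈ U → Q c (E.s e) = star (x e + c * y e) * (x e + c * y e) := by
    intro c e he
    refine (E.hatFun_s _ hs (hxy c) he).trans ?_
    rw [CompactlySupportedContinuousMap.add_apply, CompactlySupportedContinuousMap.smul_apply,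
      smul_eq_mul, Complex.star_def, ← Complex.normSq_eq_conj_mul_self, Complex.normSq_eq_norm_sq]
  have hπ : ∀ c, R.pi (Q c) = star (R.psi x + c • R.psi y) * (R.psi x + c • R.psi y) := by
    intro c
    rw [R.pi_hat, map_add, map_smul]
  -- Since |x + cy|² = |x|² + c x̄y + c̄ xȳ + |c|²|y|², these weights leave exactly x̄y; the same
  -- expansion holds in B.
  refine ⟨(1 / 4 : ℂ) • (Q 1 - Q (-1) - Complex.I • Q Complex.I
    + Complex.I • Q (-Complex.I)), ?_, ?_, ?_⟩
  · simp only [map_smul, map_add, map_sub, hπ, star_add, star_smul, add_mul, mul_add,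
      smul_mul_assoc, mul_smul_comm, star_one, star_neg, Complex.star_def, Complex.conj_I]
    match_scalars <;> ring_nf <;> simp <;> ring_nf
  · intro e he
    simp only [ZeroAtInftyContinuousMap.smul_apply, ZeroAtInftyContinuousMap.add_apply,
      ZeroAtInftyContinuousMap.sub_apply, hQ _ e he, smul_eq_mul, star_add, star_mul', star_neg,
      star_one, Complex.star_def, Complex.conj_I]
    ring_nf
    simp
    ring_nf
  · intro v hv
    have : ∀ c, Q c v = 0 := fun c => E.hatFun_eq_zero _ fun h =>
      hv (image_mono ((subset_tsupport _).trans (hxy c)) h)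
    simp [this]

/-- Relation (3) asks for disjoint sections. Disjoint compact supports have disjoint open
neighbourhoods, and intersecting the given sections with these makes them disjoint. -/
theorem star_psi_mul_psi_eq_zero {U W : Set D} (hU : IsOpen U) (hsU : E.IsSSection U)
    (hW : IsOpen W) (hsW : E.IsSSection W) {x y : C_c(D, ℂ)} (hx : tsupport x ⊆ U)
    (hy : tsupport y ⊆ W) (hxy : Disjoint (tsupport x) (tsupport y)) :
    star (R.psi x) * R.psi y = 0 := by
  obtain ⟨O₁, O₂, h1, h2, hx1, hy2, hd⟩ :=
    SeparatedNhds.of_isCompact_isCompact x.hasCompactSupport.isCompact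
      y.hasCompactSupport.isCompact hxy
  exact R.psi_disjoint x y (U ∩ O₁) (W ∩ O₂) (hU.inter h1) (hsU.domRestrict_mono inter_subset_left)
    (hW.inter h2) (hsW.domRestrict_mono inter_subset_left)
    (hd.mono inter_subset_right inter_subset_right) (subset_inter hx hx1) (subset_inter hy hy2)

/-- With d the difference of the two sides, d^*d expands into products of inner products, hence is π
of a function on E⁰. That function vanishes pointwise because z = |x|²y on U, so d = 0 by the
C*-identity. -/
theorem psi_mul_star_psi_mul_psi {U : Set D} (hU : IsOpen U) (hs : E.IsSSection U)
    {x y z : C_c(D, ℂ)} (hx : tsupport x ⊆ U) (hy : tsupport y ⊆ U) (hz : tsupport z ⊆ U)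
    (h : ∀ e ∈ U, z e = x e * star (x e) * y e) :
    R.psi x * star (R.psi x) * R.psi y = R.psi z := by
  obtain ⟨xx, hxx, hxx1, hxx0⟩ := R.exists_inner hU hs hx hx
  obtain ⟨xy, hxy, hxy1, hxy0⟩ := R.exists_inner hU hs hx hy
  obtain ⟨yx, hyx, hyx1, hyx0⟩ := R.exists_inner hU hs hy hx
  obtain ⟨xz, hxz, hxz1, hxz0⟩ := R.exists_inner hU hs hx hz
  obtain ⟨zx, hzx, hzx1, hzx0⟩ := R.exists_inner hU hs hz hx
  obtain ⟨zz, hzz, hzz1, hzz0⟩ := R.exists_inner hU hs hz hz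
  have key : yx * xx * xy - yx * xz - zx * xy + zz = 0 := by
    ext v
    by_cases hv : v ∈ E.s '' U
    · obtain ⟨e, he, rfl⟩ := hv
      simp only [ZeroAtInftyContinuousMap.mul_apply, ZeroAtInftyContinuousMap.add_apply,
        ZeroAtInftyContinuousMap.sub_apply, hxx1 e he, hxy1 e he, hyx1 e he, hxz1 e he,
        hzx1 e he, hzz1 e he, h e he, ZeroAtInftyContinuousMap.zero_apply, star_mul', star_star]
      ring
    · simp [hxy0 v hv, hyx0 v hv, hxz0 v hv, hzx0 v hv, hzz0 v hv]
  rw [← sub_eq_zero, ← CStarRing.star_mul_self_eq_zero_iff]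
  have := congrArg R.pi key
  rw [map_zero, map_add, map_sub, map_sub, map_mul, map_mul, map_mul, map_mul, hxx, hxy, hyx, hxz,
    hzx, hzz] at this
  rw [← this]
  simp only [star_sub, star_mul, star_star, sub_mul, mul_sub, mul_assoc]
  abel

/-- The sheet U need not be closed, so the closure could leave it. It does not: r maps U
homeomorphically onto the base, so the part of U over the compact set supp f is compact, hence
closed in E¹. -/
theorem tsupport_pullback_subset {F : E.LocalRFibration} (hF : F.IsOpenFibration)
    {f : C_c(V, ℝ≥0)} (hf : tsupport f ⊆ F.base) {U : Set D} (hU : U ∈ F.sheets) :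
    tsupport (F.pullback hF f hf hU).sqrt.toComplex ⊆ U ∩ E.r ⁻¹' tsupport f := by
  have hc : IsCompact (U.domRestrict E.r ⁻¹' tsupport f) := by
    refine ((F.isBisection U hU).2.isInducing.isCompact_preimage_iff ?_).2
      f.hasCompactSupport.isCompact
    rw [range_domRestrict, F.image_sheet U hU]
    exact hf
  have hK : tsupport (F.pullback hF f hf hU).sqrt.toComplex ⊆
      Subtype.val '' (U.domRestrict E.r ⁻¹' tsupport f) := by
    refine closure_minimal (fun e he => ?_) (hc.image continuous_subtype_val).isClosed
    have h1 : U.indicator (f ∘ E.r) e ≠ 0 := fun h0 => he (by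
      change ((NNReal.sqrt (U.indicator (f ∘ E.r) e) : ℝ) : ℂ) = 0
      simp [h0])
    have heU := mem_of_indicator_ne_zero h1
    rw [indicator_of_mem heU] at h1
    exact ⟨⟨e, heU⟩, subset_tsupport _ h1, rfl⟩
  refine hK.trans ?_
  rintro _ ⟨e, he, rfl⟩
  exact ⟨e.2, he⟩

theorem toComplex_sqrt_mul_star {X : Type*} [TopologicalSpace X] (g : C_c(X, ℝ≥0)) (e : X) :
    g.sqrt.toComplex e * star (g.sqrt.toComplex e) = ((g e : ℝ) : ℂ) := by
  change ((NNReal.sqrt (g e) : ℝ) : ℂ) * star ((NNReal.sqrt (g e) : ℝ) : ℂ) = _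
  rw [Complex.star_def, Complex.conj_ofReal, ← Complex.ofReal_mul, ← NNReal.coe_mul,
    NNReal.mul_self_sqrt]

theorem tsupport_lact_subset (f : C₀(V, ℂ)) (x : C_c(D, ℂ)) :
    tsupport (E.lact f x) ⊆ tsupport x :=
  closure_mono fun e he => right_ne_zero_of_mul (a := f (E.r e)) he

/-- The right hand side of the fibration identity acts on `ψ(C_c(E¹))` as `π(f)` does. -/
theorem sum_pullback_mul_psi {F : E.LocalRFibration} (hF : F.IsOpenFibration)
    {f : C_c(V, ℝ≥0)} (hf : tsupport f ⊆ F.base) (y : C_c(D, ℂ)) :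
    (∑ U ∈ F.sheets.attach, R.psi (F.pullback hF f hf U.2).sqrt.toComplex *
      star (R.psi (F.pullback hF f hf U.2).sqrt.toComplex)) * R.psi y =
      R.pi f.toComplex.toC0 * R.psi y := by
  set k := ∑ U ∈ F.sheets.attach, R.psi (F.pullback hF f hf U.2).sqrt.toComplex *
      star (R.psi (F.pullback hF f hf U.2).sqrt.toComplex) with hk
  let S : Submodule ℂ C_c(D, ℂ) := LinearMap.ker
    ((LinearMap.mulLeft ℂ k - LinearMap.mulLeft ℂ (R.pi f.toComplex.toC0)).comp R.psi)
  have hS : ∀ z, z ∈ S ↔ k * R.psi z = R.pi f.toComplex.toC0 * R.psi z := fun z => by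
    simp [S, sub_eq_zero]
  refine (hS y).1 (CompactlySupportedContinuousMap.mem_submodule_of_locally S y fun e _ => ?_)
  have hx := fun (U : Set D) (hU : U ∈ F.sheets) => tsupport_pullback_subset hF hf hU
  by_cases he : E.r e ∈ F.base
  · have he' : e ∈ ⋃ U ∈ F.sheets, U := F.preimage_base ▸ he
    obtain ⟨U, hU, heU⟩ := mem_iUnion₂.1 he'
    refine ⟨U, (hF.1 U hU).mem_nhds heU, fun z hz => (hS z).2 ?_⟩
    rw [← R.psi_lact, hk, Finset.sum_mul, Finset.sum_eq_single ⟨U, hU⟩]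
    · refine R.psi_mul_star_psi_mul_psi (hF.1 U hU) (F.isBisection U hU).1
        ((hx U hU).trans inter_subset_left) hz ((tsupport_lact_subset _ _).trans hz) ?_
      intro e he
      rw [toComplex_sqrt_mul_star]
      change ((f (E.r e) : ℝ) : ℂ) * z e = ((U.indicator (f ∘ E.r) e : ℝ≥0) : ℝ) * z e
      rw [indicator_of_mem he]
      rfl
    · intro U' _ hne
      have hd : Disjoint U'.1 U := F.pairwiseDisjoint U'.2 hU fun h => hne (Subtype.ext h)
      rw [mul_assoc, R.psi_disjoint _ z U'.1 U (hF.1 _ U'.2) (F.isBisection _ U'.2).1 (hF.1 U hU)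
        (F.isBisection U hU).1 hd ((hx _ U'.2).trans inter_subset_left) hz, mul_zero]
    · exact fun h => absurd (Finset.mem_attach _ _) h
  -- Away from the base, restrict to where r avoids supp f: there both sides vanish, the left one
  -- because the supports of z and of every pullback are disjoint.
  · obtain ⟨W, hW, heW, hsW⟩ := E.isLocalHomeomorph_s.exists_isOpen_isEmbedding_domRestrict e
    have hO : IsOpen (E.r ⁻¹' (tsupport f)ᶜ) :=
      (isClosed_tsupport f).isOpen_compl.preimage E.continuous_r
    refine ⟨W ∩ E.r ⁻¹' (tsupport f)ᶜ, (hW.inter hO).mem_nhds ⟨heW, fun h => he (hf h)⟩,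
      fun z hz => (hS z).2 ?_⟩
    have h0 : E.lact f.toComplex.toC0 z = 0 := by
      ext e
      change ((f (E.r e) : ℝ) : ℂ) * z e = 0
      by_cases h : e ∈ tsupport z
      · have : f (E.r e) = 0 := image_eq_zero_of_notMem_tsupport (hz h).2
        simp [this]
      · simp [image_eq_zero_of_notMem_tsupport h]
    rw [← R.psi_lact, h0, map_zero, hk, Finset.sum_mul]
    refine Finset.sum_eq_zero fun U _ => ?_
    rw [mul_assoc, R.star_psi_mul_psi_eq_zero (hF.1 _ U.2) (F.isBisection _ U.2).1 hW hsW
      ((hx _ U.2).trans inter_subset_left) (hz.trans inter_subset_left), mul_zero]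
    exact disjoint_left.2 fun a h1 h2 => (hz h2).2 ((hx _ U.2) h1).2

/-! ### The closed span of the elements ψ(x)ψ(y)^* -/

/-- The closed linear span of the elements `ψ(x) ψ(y)^*`. -/
noncomputable def compacts : Submodule ℂ B :=
  (Submodule.span ℂ (range fun p : C_c(D, ℂ) × C_c(D, ℂ) =>
    R.psi p.1 * star (R.psi p.2))).topologicalClosure

theorem mem_compacts (x y : C_c(D, ℂ)) : R.psi x * star (R.psi y) ∈ R.compacts :=
  Submodule.le_topologicalClosure _ (Submodule.subset_span ⟨(x, y), rfl⟩)

theorem compacts_induction {p : B → Prop} (hp : IsClosed {b | p b})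
    (hmem : ∀ x y, p (R.psi x * star (R.psi y))) (h0 : p 0)
    (hadd : ∀ a b, p a → p b → p (a + b)) (hsmul : ∀ (c : ℂ) a, p a → p (c • a))
    {b : B} (hb : b ∈ R.compacts) : p b := by
  refine closure_minimal (t := {b | p b}) (fun a ha => ?_) hp hb
  refine Submodule.span_induction ?_ h0 (fun a b _ _ => hadd a b) (fun c a _ => hsmul c a) ha
  rintro _ ⟨⟨x, y⟩, rfl⟩
  exact hmem x y

theorem isClosed_compacts : IsClosed (R.compacts : Set B) :=
  Submodule.isClosed_topologicalClosure _

theorem star_mem_compacts {b : B} (hb : b ∈ R.compacts) : star b ∈ R.compacts := by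
  refine R.compacts_induction (p := fun b => star b ∈ R.compacts)
    (R.isClosed_compacts.preimage continuous_star) ?_ ?_ ?_ ?_ hb
  · intro x y
    rw [star_mul, star_star]
    exact R.mem_compacts y x
  · rw [star_zero]; exact zero_mem _
  · intro a b ha hb
    rw [star_add]; exact add_mem ha hb
  · intro c a ha
    rw [star_smul]; exact Submodule.smul_mem _ _ ha

theorem pi_mul_mem_compacts (g : C₀(V, ℂ)) {b : B} (hb : b ∈ R.compacts) :
    R.pi g * b ∈ R.compacts := by
  refine R.compacts_induction (p := fun b => R.pi g * b ∈ R.compacts)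
    (R.isClosed_compacts.preimage (continuous_const.mul continuous_id)) ?_ ?_ ?_ ?_ hb
  · intro x y
    rw [← mul_assoc, ← R.psi_lact]
    exact R.mem_compacts _ _
  · rw [mul_zero]; exact zero_mem _
  · intro a b ha hb
    rw [mul_add]; exact add_mem ha hb
  · intro c a ha
    rw [mul_smul_comm]; exact Submodule.smul_mem _ _ ha

/-- The hypothesis gives bψ(x)ψ(y)^* = 0, so by linearity and continuity b annihilates all of
`compacts`, in particular b^*. -/
theorem eq_zero_of_mem_compacts {b : B} (hb : b ∈ R.compacts) (h : ∀ y, b * R.psi y = 0) :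
    b = 0 := by
  rw [← CStarRing.mul_star_self_eq_zero_iff]
  refine R.compacts_induction (p := fun a => b * a = 0)
    (isClosed_singleton.preimage (continuous_const.mul continuous_id)) ?_ (mul_zero _) ?_ ?_
    (R.star_mem_compacts hb)
  · intro x y
    rw [← mul_assoc, h, zero_mul]
  · intro a a' ha ha'
    rw [mul_add, ha, ha', add_zero]
  · intro c a ha
    rw [mul_smul_comm, ha, smul_zero]

open scoped CStarAlgebra in
-- Covariance is used only here, and only through the shape of π(f) for generators f; the cover and
-- the functions f_N play no role.
theorem IsCovariant.pi_mem_compacts {R : E.ToeplitzRep B} (hR : R.IsCovariant) {g : C₀(V, ℂ)}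
    (hg : ∀ v, v ∉ E.rg → g v = 0) : R.pi g ∈ R.compacts := by
  obtain ⟨G, ⟨-, hG⟩, hcov⟩ := hR
  have hg' : g ∈ ((NonUnitalStarAlgebra.adjoin ℂ
      ((fun f : C_c(V, ℝ≥0) => f.toComplex.toC0) '' G)).topologicalClosure : Set C₀(V, ℂ)) :=
    hG ▸ hg
  have hc : Continuous R.pi := map_continuous R.pi
  refine closure_minimal (t := {g | R.pi g ∈ R.compacts}) (fun g hg => ?_)
    (R.isClosed_compacts.preimage hc) hg'
  induction hg using NonUnitalStarAlgebra.adjoin_induction with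
  | mem x hx =>
    obtain ⟨f, hf, rfl⟩ := hx
    obtain ⟨𝒩, fN, -, -, -, -, h⟩ := hcov f hf
    change R.pi f.toComplex.toC0 ∈ R.compacts
    rw [h]
    exact sum_mem fun N _ => R.mem_compacts _ _
  | add x y _ _ hx hy =>
    change R.pi _ ∈ R.compacts
    rw [map_add]; exact add_mem hx hy
  | zero =>
    change R.pi _ ∈ R.compacts
    rw [map_zero]; exact zero_mem _
  | mul x y _ _ hx hy =>
    change R.pi _ ∈ R.compacts
    rw [map_mul]; exact R.pi_mul_mem_compacts x hy
  | smul c x _ hx =>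
    change R.pi _ ∈ R.compacts
    rw [map_smul]; exact Submodule.smul_mem _ _ hx
  | star x _ hx =>
    change R.pi _ ∈ R.compacts
    rw [map_star]; exact R.star_mem_compacts hx

theorem IsCovariant.fibrationIdentity {R : E.ToeplitzRep B} (hR : R.IsCovariant)
    {f : C_c(V, ℝ≥0)} (hfrg : tsupport f ⊆ E.rg) (F : E.LocalRFibration)
    (hF : F.IsOpenFibration) (hf : tsupport f ⊆ F.base) : R.FibrationIdentity f F hF hf := by
  refine sub_eq_zero.1 (R.eq_zero_of_mem_compacts (sub_mem (hR.pi_mem_compacts fun v hv => ?_)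
    (sum_mem fun U _ => R.mem_compacts _ _)) fun y => ?_)
  · have : f v = 0 := image_eq_zero_of_notMem_tsupport fun h => hv (hfrg h)
    change ((f v : ℝ) : ℂ) = 0
    simp [this]
  · rw [sub_mul, R.sum_pullback_mul_psi hF hf y, sub_self]

/-- The identity over an open local `r`-fibration is an instance of the covariance condition. -/
theorem isCovariant_of_fibrationIdentity {G : Set C_c(V, ℝ≥0)} (hG : E.IsGeneratingFamily G)
    (h : ∀ f ∈ G, ∃ (F : E.LocalRFibration) (hF : F.IsOpenFibration) (hf : tsupport f ⊆ F.base),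
      R.FibrationIdentity f F hF hf) : R.IsCovariant := by
  classical
  refine ⟨G, hG, fun f hfG => ?_⟩
  obtain ⟨F, hF, hf, hid⟩ := h f hfG
  have hfN : ∀ (N : Set D) (hN : N ∈ F.sheets),
      (if h : N ∈ F.sheets then F.pullback hF f hf h else 0) = F.pullback hF f hf hN :=
    fun N hN => dif_pos hN
  -- The family must be indexed by all subsets of E¹, hence the irrelevant value 0 off the sheets.
  refine ⟨F.sheets, fun N => if h : N ∈ F.sheets then F.pullback hF f hf h else 0,
    fun N hN => ⟨hF.1 N hN, (F.isBisection N hN).1⟩, ?_, fun N hN => ?_, fun e => ?_, ?_⟩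
  · rw [← F.preimage_base]
    exact preimage_mono hf
  · simp only [hfN N hN]
    intro e he
    have he' : N.indicator (f ∘ E.r) e ≠ 0 := he
    have heN := mem_of_indicator_ne_zero he'
    rw [indicator_of_mem heN] at he'
    exact ⟨heN, subset_tsupport _ he'⟩
  · have hval : ∀ N ∈ F.sheets, (if h : N ∈ F.sheets then F.pullback hF f hf h else 0) e =
        N.indicator (f ∘ E.r) e := fun N hN => by rw [hfN N hN]; rfl
    rw [Finset.sum_congr rfl hval]
    by_cases he : E.r e ∈ F.base
    · have he' : e ∈ ⋃ U ∈ F.sheets, U := F.preimage_base ▸ he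
      obtain ⟨U, hU, heU⟩ := mem_iUnion₂.1 he'
      rw [Finset.sum_eq_single_of_mem U hU, indicator_of_mem heU]
      · rfl
      · intro U' hU' hne
        exact indicator_of_notMem (fun h =>
          disjoint_left.1 (F.pairwiseDisjoint hU' hU hne) h heU) _
    · have h0 : f (E.r e) = 0 := image_eq_zero_of_notMem_tsupport fun h => he (hf h)
      rw [h0]
      refine Finset.sum_eq_zero fun U _ => ?_
      simp [indicator_apply, h0]
  · rw [hid, ← Finset.sum_attach F.sheets]
    refine Finset.sum_congr rfl fun U _ => ?_
    simp only [hfN U.1 U.2]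

end ToeplitzRep

end TopologicalGraph

/-! ### Existence of open local r-fibrations -/

namespace TopologicalGraph

variable {V D : Type*} [TopologicalSpace V] [T2Space V] [LocallyCompactSpace V]
  [TopologicalSpace D] [T2Space D] [LocallyCompactSpace D] {E : TopologicalGraph V D}

theorem isOpen_rg : IsOpen E.rg := by
  refine IsOpen.sdiff (isOpen_iff_mem_nhds.2 ?_) isClosed_closure
  rintro v ⟨N, hN, hc⟩
  filter_upwards [eventually_mem_nhds_iff.2 hN] with w hw using ⟨N, hw, hc⟩

/-- If `r` is a local homeomorphism, then every vertex of `E⁰_fin` lies in the base of an open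
local `r`-fibration. -/
theorem exists_isOpenFibration (hr : IsLocalHomeomorph E.r) {v : V} (hv : v ∈ E.fin) :
    ∃ F : E.LocalRFibration, F.IsOpenFibration ∧ v ∈ F.base := by
  classical
  obtain ⟨N, hN, hNc⟩ := hv
  choose S hSo hSe hSs using E.isLocalHomeomorph_s.exists_isOpen_isEmbedding_domRestrict
  choose T hTo hTe hTr using hr.exists_isOpen_isEmbedding_domRestrict
  have hZ : IsCompact (E.r ⁻¹' {v}) :=
    hNc.of_isClosed_subset (isClosed_singleton.preimage E.continuous_r)
      (preimage_mono (singleton_subset_iff.2 (mem_of_mem_nhds hN)))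
  obtain ⟨t, htv, htc⟩ := hZ.elim_nhds_subcover T fun e _ => (hTo e).mem_nhds (hTe e)
  -- Each r-section T e' meets the fibre over v in at most one point, so the finite subcover of the
  -- compact fibre lists all its points.
  have htv' : ∀ e, E.r e = v ↔ e ∈ t := by
    refine fun e => ⟨fun he => ?_, htv e⟩
    obtain ⟨e', he', hee'⟩ := mem_iUnion₂.1 (htc he)
    have : e = e' := injOn_iff_injective.2 (hTr e').injective hee' (hTe e')
      (he.trans (htv e' he').symm)
    exact this ▸ he'
  obtain ⟨O, hO, hOd⟩ := t.finite_toSet.t2_separation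
  set W : D → Set D := fun e => S e ∩ T e ∩ O e with hW
  have hWo : ∀ e, IsOpen (W e) := fun e => ((hSo e).inter (hTo e)).inter (hO e).2
  have hWe : ∀ e, e ∈ W e := fun e => ⟨⟨hSe e, hTe e⟩, (hO e).1⟩
  -- C collects the edges over N outside the chosen bisections. It is compact and misses the fibre,
  -- so removing its closed image from the base keeps v and leaves only edges in some W e.
  set C : Set D := E.r ⁻¹' N \ ⋃ e ∈ t, W e with hC
  have hCc : IsClosed (E.r '' C) :=
    ((hNc.diff (isOpen_biUnion fun e _ => hWo e)).image E.continuous_r).isClosed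
  set b : Set V := interior N ∩ (⋂ e ∈ t, E.r '' W e) ∩ (E.r '' C)ᶜ with hb
  have hbo : IsOpen b := (isOpen_interior.inter
    (isOpen_biInter_finset fun e _ => hr.isOpenMap _ (hWo e))).inter hCc.isOpen_compl
  have hvb : v ∈ b := by
    refine ⟨⟨mem_interior_iff_mem_nhds.2 hN, mem_iInter₂.2 fun e he =>
      ⟨e, hWe e, (htv' e).2 he⟩⟩, ?_⟩
    rintro ⟨e, he, hev⟩
    exact he.2 (mem_iUnion₂.2 ⟨e, (htv' e).1 hev, hWe e⟩)
  refine ⟨⟨t.image fun e => W e ∩ E.r ⁻¹' b, b, ?_, ?_, ?_, ?_⟩, ⟨?_, hbo⟩, hvb⟩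
  · simp only [Finset.forall_mem_image]
    exact fun e _ => ⟨(hSs e).domRestrict_mono fun x hx => hx.1.1.1,
      (hTr e).domRestrict_mono fun x hx => hx.1.1.2⟩
  · intro A hA A' hA' hne
    obtain ⟨e, he, rfl⟩ := Finset.mem_image.1 (Finset.mem_coe.1 hA)
    obtain ⟨e', he', rfl⟩ := Finset.mem_image.1 (Finset.mem_coe.1 hA')
    exact (hOd he he' fun h => hne (h ▸ rfl)).mono (fun x hx => hx.1.2) fun x hx => hx.1.2
  · ext x
    simp only [Finset.mem_image, iUnion_exists, biUnion_and', iUnion_iUnion_eq_right, mem_iUnion,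
      exists_prop]
    refine ⟨fun hx => ?_, fun ⟨e, _, hx⟩ => hx.2⟩
    by_contra h
    refine hx.2 ⟨x, ⟨interior_subset (s := N) hx.1.1, fun hx' => h ?_⟩, rfl⟩
    obtain ⟨e, he, hxe⟩ := mem_iUnion₂.1 hx'
    exact ⟨e, he, hxe, hx⟩
  · simp only [Finset.forall_mem_image]
    intro e he
    rw [image_inter_preimage, inter_eq_right]
    exact fun w hw => mem_iInter₂.1 hw.1.2 e he
  · simp only [Finset.forall_mem_image]
    exact fun e _ => (hWo e).inter (hbo.preimage E.continuous_r)

end TopologicalGraph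

/-! ### Generating families for C₀(E⁰_rg) -/

namespace CompactlySupportedContinuousMap

variable {X : Type*} [TopologicalSpace X]

/-- The positive part of the real part of `c f`. -/
noncomputable def posRe (c : ℂ) (f : C_c(X, ℂ)) : C_c(X, ℝ≥0) where
  toFun x := (c * f x).re.toNNReal
  continuous_toFun := continuous_real_toNNReal.comp
    (Complex.continuous_re.comp (continuous_const.mul f.continuous))
  hasCompactSupport' := f.hasCompactSupport.comp_left
    (g := fun z : ℂ => (c * z).re.toNNReal) (by simp)

theorem tsupport_posRe_subset (c : ℂ) (f : C_c(X, ℂ)) : tsupport (posRe c f) ⊆ tsupport f := by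
  refine closure_mono fun x hx h0 => hx ?_
  change (c * f x).re.toNNReal = 0
  simp [h0]

/-- Split real and imaginary parts into positive and negative parts, using Im f = Re(-if). -/
theorem toC0_eq_posRe (f : C_c(X, ℂ)) : f.toC0 =
    ((posRe 1 f).toComplex.toC0 - (posRe (-1) f).toComplex.toC0) +
    Complex.I • ((posRe (-Complex.I) f).toComplex.toC0 - (posRe Complex.I f).toComplex.toC0) := by
  ext x
  change f x = ((((1 * f x).re.toNNReal : ℝ) : ℂ) - (((-1 * f x).re.toNNReal : ℝ) : ℂ)) +
    Complex.I * ((((-Complex.I * f x).re.toNNReal : ℝ) : ℂ) -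
      (((Complex.I * f x).re.toNNReal : ℝ) : ℂ))
  have h : ∀ a : ℝ, max a 0 - max (-a) 0 = a := fun a => by
    rcases le_total a 0 with h | h <;> simp [h]
  have h1 := h (f x).re
  have h2 := h (f x).im
  apply Complex.ext <;> simp [Real.coe_toNNReal', h1, h2]

/-- The inclusion of `C_c(X)` in `C₀(X)` as a linear map. -/
noncomputable def toC0Linear : C_c(X, ℂ) →ₗ[ℂ] C₀(X, ℂ) where
  toFun := toC0
  map_add' _ _ := rfl
  map_smul' _ _ := rfl

end CompactlySupportedContinuousMap

namespace TopologicalGraph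

open CompactlySupportedContinuousMap

variable {V D : Type*} [TopologicalSpace V] [T2Space V] [LocallyCompactSpace V]
  [TopologicalSpace D] [T2Space D] [LocallyCompactSpace D] {E : TopologicalGraph V D}

/-- A family of nonnegative functions in `C_c(E⁰_rg)` that contains all functions supported in
sufficiently small open sets generates `C₀(E⁰_rg)`. -/
theorem isGeneratingFamily_of_locally {G : Set C_c(V, ℝ≥0)} (hG : ∀ f ∈ G, tsupport f ⊆ E.rg)
    (hloc : ∀ v ∈ E.rg, ∃ W ∈ 𝓝 v, ∀ f : C_c(V, ℝ≥0), tsupport f ⊆ W → f ∈ G) :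
    E.IsGeneratingFamily G := by
  refine ⟨hG, Subset.antisymm ?_ ?_⟩
  · refine closure_minimal (fun g hg => ?_) ?_
    · change ∀ v, v ∉ E.rg → g v = 0
      intro v hv
      induction hg using NonUnitalStarAlgebra.adjoin_induction with
      | mem x hx =>
        obtain ⟨f, hf, rfl⟩ := hx
        have : f v = 0 := image_eq_zero_of_notMem_tsupport fun h => hv (hG f hf h)
        change ((f v : ℝ) : ℂ) = 0
        simp [this]
      | add x y _ _ hx hy => simp [hx, hy]
      | zero => rfl
      | mul x y _ _ hx hy => simp [hx]
      | smul c x _ hx => simp [hx]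
      | star x _ hx => simp [hx]
    · simp only [ofPred_forall]
      refine isClosed_iInter fun v => isClosed_iInter fun _ => ?_
      refine isClosed_singleton.preimage (f := fun g : C₀(V, ℂ) => g v) ?_
      exact (continuous_eval_const (F := BoundedContinuousFunction V ℂ) v).comp
        ZeroAtInftyContinuousMap.isometry_toBCF.continuous
  · intro g hg
    set A := NonUnitalStarAlgebra.adjoin ℂ
      ((fun f : C_c(V, ℝ≥0) => f.toComplex.toC0) '' G) with hA
    -- The partition of unity puts all of C_c(E⁰_rg) in the algebra before closure; density in
    -- C₀(E⁰_rg) then follows by cutting off.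
    have hcc : ∀ y : C_c(V, ℂ), tsupport y ⊆ E.rg → y.toC0 ∈ A := by
      intro y hy
      have := mem_submodule_of_locally
        (Submodule.comap toC0Linear A.toNonUnitalSubalgebra.toSubmodule) y fun v hv => ?_
      · exact this
      · obtain ⟨W, hW, hWG⟩ := hloc v (hy hv)
        refine ⟨W, hW, fun z hz => ?_⟩
        have hp : ∀ c, (posRe c z).toComplex.toC0 ∈ A := fun c =>
          NonUnitalStarAlgebra.subset_adjoin ℂ _
            ⟨_, hWG _ ((tsupport_posRe_subset c z).trans hz), rfl⟩
        change z.toC0 ∈ A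
        rw [toC0_eq_posRe]
        exact add_mem (sub_mem (hp _) (hp _)) (SMulMemClass.smul_mem _ (sub_mem (hp _) (hp _)))
    change g ∈ closure (A : Set C₀(V, ℂ))
    refine Metric.mem_closure_iff.2 fun ε hε => ?_
    have hK : IsCompact {v | ε / 2 ≤ ‖g v‖} := by
      have h := g.zero_at_infty'.norm
      rw [norm_zero] at h
      obtain ⟨K, hK, hKg⟩ := Filter.mem_cocompact.1 (h (Iio_mem_nhds (half_pos hε)))
      refine hK.of_isClosed_subset (isClosed_le continuous_const (map_continuous g).norm) ?_
      intro v hv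
      by_contra hvK
      exact not_lt.2 (show ε / 2 ≤ ‖g v‖ from hv) (hKg hvK)
    have hKrg : {v | ε / 2 ≤ ‖g v‖} ⊆ E.rg := fun v hv => by
      by_contra h
      have h0 : g v = 0 := hg v h
      have : ε / 2 ≤ ‖g v‖ := hv
      rw [h0, norm_zero] at this
      linarith
    obtain ⟨L, hL, hKL, hLrg⟩ := exists_compact_between hK isOpen_rg hKrg
    obtain ⟨φ, hφ1, hφ0, hφc, hφ⟩ := exists_continuous_one_zero_of_isCompact hK
      isOpen_interior.isClosed_compl (disjoint_compl_right_iff_subset.2 hKL)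
    let y : C_c(V, ℂ) :=
      { toFun := fun v => ((φ v : ℝ) : ℂ) * g v
        continuous_toFun := by fun_prop
        hasCompactSupport' := (hφc.comp_left (g := fun t : ℝ => (t : ℂ)) (by simp)).mul_right }
    have hy : tsupport y ⊆ E.rg := by
      refine (closure_minimal (fun v hv => ?_) hL.isClosed).trans hLrg
      by_contra h
      refine hv ?_
      change ((φ v : ℝ) : ℂ) * g v = 0
      rw [hφ0 fun h' => h (interior_subset h')]
      simp
    refine ⟨y.toC0, hcc y hy, ?_⟩
    -- The error (1 - φ)g is zero where |g| ≥ ε/2 and at most |g| < ε/2 elsewhere.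
    rw [← ZeroAtInftyContinuousMap.dist_toBCF_eq_dist]
    refine lt_of_le_of_lt ((BoundedContinuousFunction.dist_le (half_pos hε).le).2 fun v => ?_)
      (half_lt_self hε)
    change dist (g v) (((φ v : ℝ) : ℂ) * g v) ≤ ε / 2
    by_cases hv : ε / 2 ≤ ‖g v‖
    · rw [hφ1 hv]
      simpa using (half_pos hε).le
    · have h1 : g v - ((φ v : ℝ) : ℂ) * g v = ((1 - φ v : ℝ) : ℂ) * g v := by
        push_cast
        ring
      rw [dist_eq_norm, h1, norm_mul, Complex.norm_real, Real.norm_eq_abs,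
        abs_of_nonneg (sub_nonneg.2 (hφ v).2)]
      have h2 := (hφ v).1
      have h3 := norm_nonneg (g v)
      nlinarith [mul_nonneg h2 h3]

end TopologicalGraph

/-! ### The corollary -/

theorem mainTheorem4 {V D : Type*} [TopologicalSpace V] [T2Space V] [LocallyCompactSpace V]
    [TopologicalSpace D] [T2Space D] [LocallyCompactSpace D] (E : TopologicalGraph V D)
    (hr : IsLocalHomeomorph E.r) (hclosed : IsClosed (Set.range E.r))
    {B : Type*} [NonUnitalCStarAlgebra B] (R : E.ToeplitzRep B) :
    (R.IsCovariant ↔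
      ∃ G : Set C_c(V, ℝ≥0), E.IsGeneratingFamily G ∧
        ∀ f ∈ G, ∃ (F : E.LocalRFibration) (hF : F.IsOpenFibration) (hf : tsupport f ⊆ F.base),
          R.FibrationIdentity f F hF hf) ∧
    (R.IsCovariant →
      ∀ f : C_c(V, ℝ≥0), tsupport f ⊆ E.rg →
        ∀ (F : E.LocalRFibration) (hF : F.IsOpenFibration) (hf : tsupport f ⊆ F.base),
          R.FibrationIdentity f F hF hf) := by
  refine ⟨⟨fun hR => ?_, fun ⟨G, hG, h⟩ => R.isCovariant_of_fibrationIdentity hG h⟩,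
    fun hR f hf F hF hfF => hR.fibrationIdentity hf F hF hfF⟩
  -- The largest candidate family is taken: it contains every function supported in a small enough
  -- neighbourhood of a regular vertex.
  refine ⟨{f | tsupport f ⊆ E.rg ∧ ∃ F : E.LocalRFibration, F.IsOpenFibration ∧
    tsupport f ⊆ F.base}, TopologicalGraph.isGeneratingFamily_of_locally (fun f hf => hf.1)
      fun v hv => ?_, ?_⟩
  · obtain ⟨F, hF, hvF⟩ := TopologicalGraph.exists_isOpenFibration hr hv.1
    exact ⟨E.rg ∩ F.base, (TopologicalGraph.isOpen_rg.inter hF.2).mem_nhds ⟨hv, hvF⟩,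
      fun f hf => ⟨hf.trans inter_subset_left, F, hF, hf.trans inter_subset_right⟩⟩
  · rintro f ⟨hf, F, hF, hfF⟩
    exact ⟨F, hF, hfF, hR.fibrationIdentity hf F hF hfF⟩
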